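/- Fix an integer $m\ge 1$ and let $G_m^n$ be the Bollobás–Riordan preferential attachment multigraph on the vertex set $[n]=\{1,\dots,n\}$: the vertices $1,2,\dots,n$ arrive in this order, and each vertex $t$ sends out $m$ edges, added one at a time; each such edge attaches to a vertex $s\in[t]$ with conditional probability, given all the previous edges, proportional to the current degree of $s$, where the previous edges (a loop contributing $2$) and also the outward half of the edge being added count towards the degrees. Say that $b$ selects $a$ if one of the $m$ edges sent out by $b$ attaches to $a$. A recursive tree of $G_m^n$ is a subtree $T$ of $G_m^n$ with a root $r$ such that the vertices increase along every path of $T$ starting from $r$; a single vertex is a recursive tree. It is maximal if no vertex of $[n]\setminus V(T)$ selects a vertex of $V(T)$. "Whp" means with probability tending to $1$ as $n\to\infty$. (1) For every $\varepsilon>0$, whp there is no maximal recursive tree $T$ of $G_m^n$ all of whose vertices $v$ satisfy $v\le n^{\frac{m}{m+4}-\varepsilon}$. (2) Let $\mu=\mu(n)>0$ satisfy $\mu\to\infty$ and $\mu=o(n)$. Then for every constant $\alpha>0$, whp no set $A\subseteq\{v\in[n]: v\le\mu\}$ with $|A|\ge\alpha\mu$ is the vertex set of a maximal recursive tree of $G_m^n$.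 -/

import Mathlib

open Filter Topology Asymptotics
open scoped ENNReal

namespace PrefAttach

/-! The preferential attachment multigraph with vertex set `{1, …, n}`, in which every vertex sends
out `m` edges, added one at a time. The edges are numbered `0, 1, 2, …` in the order of their
creation; edge number `k` emanates from the vertex `source m k`. A realization of the process is
recorded as the sequence `g`, where `g k` is the vertex that edge number `k` attaches to. -/

/-- The vertex from which edge number `k` emanates: edges `0, …, m - 1` emanate from vertex `1`,
edges `m, …, 2 * m - 1` from vertex `2`, and so on. -/
def source (m k : ℕ) : ℕ := k / m + 1

/-- The degree of the vertex `v` in the multigraph formed by the first `k` edges; a loop counts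
twice. -/
def degreeBefore (m : ℕ) (g : ℕ → ℕ) (k v : ℕ) : ℕ :=
  ((Finset.range k).filter fun j => source m j = v).card +
    ((Finset.range k).filter fun j => g j = v).card

/-- The degree of `v` just before edge number `k` chooses its second end: the previous edges are
counted, and so is the outward half of the edge being added. -/
def attachWeight (m : ℕ) (g : ℕ → ℕ) (k v : ℕ) : ℕ :=
  degreeBefore m g k v + if v = source m k then 1 else 0

theorem tsum_card_fiber (f : ℕ → ℕ) (k : ℕ) :
    ∑' v, ((((Finset.range k).filter fun j => f j = v).card : ℕ) : ℝ≥0∞) = k := by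
  rw [tsum_eq_sum (s := (Finset.range k).image f)]
  · rw [← Nat.cast_sum, ← Finset.card_eq_sum_card_image, Finset.card_range]
  · intro v hv
    rw [Nat.cast_eq_zero, Finset.card_eq_zero, Finset.filter_eq_empty_iff]
    intro j hj h
    exact hv (Finset.mem_image.2 ⟨j, hj, h⟩)

theorem tsum_attachWeight (m : ℕ) (g : ℕ → ℕ) (k : ℕ) :
    ∑' v, (attachWeight m g k v : ℝ≥0∞) = 2 * k + 1 := by
  simp only [attachWeight, degreeBefore, Nat.cast_add]
  rw [ENNReal.tsum_add, ENNReal.tsum_add, tsum_card_fiber, tsum_card_fiber, two_mul]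
  congr 1
  rw [tsum_eq_single (source m k)]
  · simp
  · intro v hv
    simp [hv]

/-- The law of the end point of edge number `k`, given the previous edges: a vertex is chosen with
probability proportional to its current degree. -/
noncomputable def attachLaw (m : ℕ) (g : ℕ → ℕ) (k : ℕ) : PMF ℕ :=
  PMF.normalize (fun v => (attachWeight m g k v : ℝ≥0∞))
    (by rw [tsum_attachWeight]; simp)
    (by rw [tsum_attachWeight]; finiteness)

/-- The law of the first `N` attachments `g 0, …, g (N - 1)` of the process (the irrelevant later
entries of `g` are `0`, which is not a vertex). -/
noncomputable def processLaw (m : ℕ) : ℕ → PMF (ℕ → ℕ)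
  | 0 => PMF.pure fun _ => 0
  | N + 1 => (processLaw m N).bind fun g => (attachLaw m g N).map (Function.update g N)

/-- The law of the random multigraph `G_m^n`, which has `m * n` edges. -/
noncomputable def graphLaw (m n : ℕ) : PMF (ℕ → ℕ) := processLaw m (m * n)

/-- In the multigraph on `{1, …, n}` given by `g`, one of the `m` edges emanating from the vertex
`b` attaches to the vertex `a`. -/
def Selects (m n : ℕ) (g : ℕ → ℕ) (b a : ℕ) : Prop :=
  ∃ k < m * n, source m k = b ∧ g k = a

/-- The simple graph underlying the multigraph on `{1, …, n}` given by `g`; numbers that are not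
in `{1, …, n}` are isolated. -/
def simpleGraph (m n : ℕ) (g : ℕ → ℕ) : SimpleGraph ℕ :=
  SimpleGraph.fromRel (Selects m n g)

/-- `T` is a recursive tree of the multigraph: a subtree with a root `r` such that the vertices
increase along every path of `T` that starts from `r`. -/
structure IsRecursiveTree {m n : ℕ} {g : ℕ → ℕ} (T : (simpleGraph m n g).Subgraph) : Prop where
  verts_subset : T.verts ⊆ Set.Icc 1 n
  isTree : T.coe.IsTree
  exists_root : ∃ r : T.verts, ∀ (v : T.verts) (p : T.coe.Walk r v),
    p.IsPath → p.support.Pairwise (· < ·)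

/-- A recursive tree is maximal if no vertex outside of it selects one of its vertices. -/
structure IsMaximalRecursiveTree {m n : ℕ} {g : ℕ → ℕ} (T : (simpleGraph m n g).Subgraph) :
    Prop extends IsRecursiveTree T where
  not_selects : ∀ c ∈ Set.Icc 1 n, c ∉ T.verts → ∀ a ∈ T.verts, ¬ Selects m n g c a

/-- `A` is the vertex set of a maximal recursive tree of the multigraph on `{1, …, n}` given
by `g`. -/
def IsMaxTreeVertexSet (m n : ℕ) (g : ℕ → ℕ) (A : Finset ℕ) : Prop :=
  ∃ T : (simpleGraph m n g).Subgraph, IsMaximalRecursiveTree T ∧ T.verts = ↑A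

/-- The events `E n` about `G_m^n` hold with high probability: `ℙ (G_m^n ∈ E n) → 1` as `n → ∞`.
For a discrete law `p`, `p.toOuterMeasure S` is the sum of the masses of the elements of `S`. -/
def Whp (m : ℕ) (E : ℕ → Set (ℕ → ℕ)) : Prop :=
  Tendsto (fun n => (graphLaw m n).toOuterMeasure (E n)) atTop (𝓝 1)

end PrefAttach

namespace PrefAttach

/-! Of the tree only two features matter: its vertex set `A` is nonempty and no outside vertex
selects it. If `A ⊆ [M]`, every edge sent out after vertex `M` must miss `A`. Each vertex of `A` has
degree at least `m` by then, so edge `k` misses `A` with conditional probability at most `1 -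
m|A|/(2k+1)`. The product over these edges is at most `q ^ |A|` with `q = (2M/n)^(m/2)`
(`graphLaw_avoid_le`). A union bound over candidates finishes. Nonempty subsets of `[M]` contribute
at most `exp(Mq) - 1`, which vanishes for `M ≤ n^s` with `s < m/(m+2)`. For dense sets, at most
`2^μ` candidates meet a bound `o(1)^μ`. -/

theorem toOuterMeasure_univ {β : Type*} (p : PMF β) : p.toOuterMeasure Set.univ = 1 :=
  (p.toOuterMeasure_apply_eq_one_iff _).2 (Set.subset_univ _)

theorem toOuterMeasure_le_one {β : Type*} (p : PMF β) (s : Set β) : p.toOuterMeasure s ≤ 1 :=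
  (MeasureTheory.measure_mono (Set.subset_univ s)).trans (toOuterMeasure_univ p).le

/-! ### Probability that late edges avoid a fixed set -/

theorem le_attachWeight {m M k a : ℕ} (g : ℕ → ℕ) (ha : a ∈ Finset.Icc 1 M) (hk : m * M ≤ k) :
    m ≤ attachWeight m g k a := by
  obtain ⟨h1, h2⟩ := Finset.mem_Icc.1 ha
  obtain ⟨b, rfl⟩ := Nat.exists_eq_add_of_le' h1
  have hsub : Finset.Ico (m * b) (m * b + m) ⊆
      (Finset.range k).filter fun j => source m j = b + 1 := by
    intro j hj
    obtain ⟨hj1, hj2⟩ := Finset.mem_Ico.1 hj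
    have hle : m * b + m ≤ m * M := by
      rw [← Nat.mul_succ]
      exact Nat.mul_le_mul_left m h2
    refine Finset.mem_filter.2 ⟨Finset.mem_range.2 (by omega), ?_⟩
    rw [source, Nat.div_eq_of_lt_le (k := b) (by rwa [Nat.mul_comm])
      (by rwa [Nat.mul_comm, Nat.mul_succ])]
  have := Finset.card_le_card hsub
  rw [Nat.card_Ico, Nat.add_sub_cancel_left] at this
  unfold attachWeight degreeBefore
  omega

/-- Once all vertices of `A ⊆ {1, …, M}` have sent out their edges, a new edge avoids `A` with
conditional probability at most `1 - m * |A| / (2 * k + 1)`. -/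
theorem attachLaw_compl_le {m M k : ℕ} (g : ℕ → ℕ) {A : Finset ℕ} (hA : A ⊆ Finset.Icc 1 M)
    (hk : m * M ≤ k) :
    (attachLaw m g k).toOuterMeasure (↑A)ᶜ ≤
      ENNReal.ofReal (Real.exp (-((m * A.card : ℕ) / (2 * k + 1 : ℝ)))) := by
  set p := attachLaw m g k
  have hsum : p.toOuterMeasure ↑A + p.toOuterMeasure (↑A)ᶜ = 1 := by
    rw [PMF.toOuterMeasure_apply, PMF.toOuterMeasure_apply, ← ENNReal.tsum_add, ← p.tsum_coe]
    exact tsum_congr fun x => Set.indicator_self_add_compl_apply _ _ _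
  have hlow : ENNReal.ofReal ((m * A.card : ℕ) / (2 * k + 1 : ℝ)) ≤ p.toOuterMeasure ↑A := by
    rw [PMF.toOuterMeasure_apply_finset]
    have hterm : ∀ a ∈ A, (m : ℝ≥0∞) * (2 * (k : ℝ≥0∞) + 1)⁻¹ ≤ p a := by
      intro a ha
      simp only [p, attachLaw, PMF.normalize_apply, tsum_attachWeight]
      gcongr
      exact le_attachWeight g (hA ha) hk
    have hcard := Finset.card_nsmul_le_sum A _ _ hterm
    refine le_trans (le_of_eq ?_) hcard
    rw [ENNReal.ofReal_div_of_pos (by positivity), ENNReal.ofReal_natCast, nsmul_eq_mul,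
      ENNReal.div_eq_inv_mul]
    have : ENNReal.ofReal (2 * k + 1 : ℝ) = 2 * k + 1 := by
      exact_mod_cast ENNReal.ofReal_natCast (2 * k + 1)
    rw [this]
    push_cast
    ring
  have hle : p.toOuterMeasure (↑A)ᶜ ≤ 1 - ENNReal.ofReal ((m * A.card : ℕ) / (2 * k + 1 : ℝ)) := by
    refine ENNReal.le_sub_of_add_le_left ENNReal.ofReal_ne_top ?_
    rw [← hsum]
    gcongr
  refine hle.trans ?_
  rw [← ENNReal.ofReal_one, ← ENNReal.ofReal_sub _ (by positivity)]
  refine ENNReal.ofReal_le_ofReal ?_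
  linarith [Real.add_one_le_exp (-((m * A.card : ℕ) / (2 * k + 1 : ℝ)))]

/-- The one-step bound is uniform in the history, so conditioning edge by edge multiplies the
bounds. -/
theorem processLaw_avoid_le {m M : ℕ} {A : Finset ℕ} (hA : A ⊆ Finset.Icc 1 M) {N : ℕ}
    (hN : m * M ≤ N) :
    (processLaw m N).toOuterMeasure {g | ∀ k, m * M ≤ k → k < N → g k ∉ A} ≤
      ENNReal.ofReal (Real.exp
        (-((m * A.card : ℕ) * ∑ k ∈ Finset.Ico (m * M) N, 1 / (2 * k + 1 : ℝ)))) := by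
  induction N, hN using Nat.le_induction with
  | base =>
    simp only [Finset.Ico_self, Finset.sum_empty, mul_zero, neg_zero, Real.exp_zero,
      ENNReal.ofReal_one]
    exact toOuterMeasure_le_one _ _
  | succ N hN ih =>
    rw [processLaw, PMF.toOuterMeasure_bind_apply]
    set c := ENNReal.ofReal (Real.exp (-((m * A.card : ℕ) / (2 * N + 1 : ℝ))))
    set S := {g : ℕ → ℕ | ∀ k, m * M ≤ k → k < N → g k ∉ A}
    have hstep : ∀ g, processLaw m N g *
        ((attachLaw m g N).map (Function.update g N)).toOuterMeasure
          {g | ∀ k, m * M ≤ k → k < N + 1 → g k ∉ A} ≤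
        S.indicator (processLaw m N) g * c := by
      intro g
      rw [PMF.toOuterMeasure_map_apply]
      by_cases hg : g ∈ S
      · rw [Set.indicator_of_mem hg]
        gcongr
        refine le_trans (MeasureTheory.measure_mono ?_) (attachLaw_compl_le g hA hN)
        intro v hv
        simpa using hv N hN (Nat.lt_succ_self N)
      -- A history that already hits `A` contributes nothing: adding edge `N` leaves earlier entries
      -- unchanged.
      · have hempty : Function.update g N ⁻¹'
            {g | ∀ k, m * M ≤ k → k < N + 1 → g k ∉ A} = ∅ := by
          refine Set.eq_empty_of_forall_notMem fun v hv => hg fun k hk hkN => ?_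
          have := hv k hk (hkN.trans (Nat.lt_succ_self N))
          rwa [Function.update_of_ne hkN.ne] at this
        rw [hempty]
        simp
    refine (ENNReal.tsum_le_tsum hstep).trans ?_
    rw [ENNReal.tsum_mul_right, ← PMF.toOuterMeasure_apply]
    refine (mul_le_mul_left ih c).trans (le_of_eq ?_)
    rw [← ENNReal.ofReal_mul (Real.exp_nonneg _), ← Real.exp_add,
      Finset.sum_Ico_succ_top hN]
    congr 2
    ring

/-- The logarithm telescopes; each increment is bounded by `log (1 + x) ≤ x` with `x = 2 / (2b +
1)`. -/
theorem log_le_sum_Ico (a b : ℕ) (hab : a ≤ b) :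
    Real.log ((2 * b + 1) / (2 * a + 1)) / 2 ≤ ∑ k ∈ Finset.Ico a b, 1 / (2 * k + 1 : ℝ) := by
  induction b, hab using Nat.le_induction with
  | base => rw [div_self (by positivity)]; simp
  | succ b hb ih =>
    rw [Finset.sum_Ico_succ_top hb]
    have hsplit : ((2 * ((b + 1 : ℕ) : ℝ) + 1) / (2 * a + 1)) =
        ((2 * b + 1) / (2 * a + 1)) * (1 + 2 / (2 * b + 1)) := by
      push_cast
      field_simp
      ring
    rw [hsplit, Real.log_mul (by positivity) (by positivity)]
    have := Real.log_le_sub_one_of_pos (x := 1 + 2 / (2 * b + 1 : ℝ)) (by positivity)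
    have h2 : 2 / (2 * b + 1 : ℝ) = 2 * (1 / (2 * b + 1)) := by ring
    rw [h2] at this ⊢
    linarith

/-- The probability that no edge sent out by the vertices `M + 1, …, n` attaches to
`A ⊆ {1, …, M}` is at most `(2 * M / n) ^ (m * |A| / 2)`. -/
theorem graphLaw_avoid_le {m M n : ℕ} (hm : 1 ≤ m) (hM : 1 ≤ M) (hMn : M ≤ n) {A : Finset ℕ}
    (hA : A ⊆ Finset.Icc 1 M) :
    (graphLaw m n).toOuterMeasure {g | ∀ k, m * M ≤ k → k < m * n → g k ∉ A} ≤
      ENNReal.ofReal (((2 * M / n : ℝ) ^ ((m : ℝ) / 2)) ^ A.card) := by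
  refine (processLaw_avoid_le hA (Nat.mul_le_mul_left m hMn)).trans (ENNReal.ofReal_le_ofReal ?_)
  have hM' : (1 : ℝ) ≤ M := by exact_mod_cast hM
  have hm' : (1 : ℝ) ≤ m := by exact_mod_cast hm
  have hn' : (1 : ℝ) ≤ n := by exact_mod_cast hM.trans hMn
  have hpos : (0 : ℝ) < 2 * M / n := by positivity
  rw [← Real.rpow_natCast, ← Real.rpow_mul hpos.le, Real.rpow_def_of_pos hpos]
  refine Real.exp_le_exp.2 ?_
  have hlog := log_le_sum_Ico (m * M) (m * n) (Nat.mul_le_mul_left m hMn)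
  -- The factor 2 in `2 * M / n` absorbs the `+ 1` terms, since `m * M ≥ 1`.
  have hratio : -Real.log (2 * M / n) ≤
      Real.log ((2 * ((m * n : ℕ) : ℝ) + 1) / (2 * ((m * M : ℕ) : ℝ) + 1)) := by
    rw [← Real.log_inv, inv_div]
    refine Real.log_le_log (by positivity) ?_
    push_cast
    rw [div_le_div_iff₀ (by positivity) (by positivity)]
    nlinarith [mul_le_mul hm' hM' zero_le_one (by positivity)]
  have hc : (0 : ℝ) ≤ ((m * A.card : ℕ) : ℝ) := Nat.cast_nonneg _
  have := mul_le_mul_of_nonneg_left (hlog.trans' (div_le_div_of_nonneg_right hratio zero_le_two)) hc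
  push_cast at this ⊢
  linarith

/-! ### From maximal trees to the union bound -/

theorem IsMaxTreeVertexSet.subset_Icc {m n : ℕ} {g : ℕ → ℕ} {A : Finset ℕ}
    (h : IsMaxTreeVertexSet m n g A) : A ⊆ Finset.Icc 1 n := by
  obtain ⟨T, hT, hTA⟩ := h
  intro a ha
  exact Finset.mem_Icc.2 (hT.verts_subset (hTA ▸ Finset.mem_coe.2 ha))

theorem IsMaxTreeVertexSet.nonempty {m n : ℕ} {g : ℕ → ℕ} {A : Finset ℕ}
    (h : IsMaxTreeVertexSet m n g A) : A.Nonempty := by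
  obtain ⟨T, hT, hTA⟩ := h
  obtain ⟨r, -⟩ := hT.exists_root
  exact ⟨r, Finset.mem_coe.1 (hTA ▸ r.2)⟩

/-- Edges numbered from `m * M` on emanate from vertices above `M`, hence from outside `A`, so
maximality applies. -/
theorem IsMaxTreeVertexSet.avoid {m n M : ℕ} (hm : 1 ≤ m) {g : ℕ → ℕ} {A : Finset ℕ}
    (h : IsMaxTreeVertexSet m n g A) (hA : A ⊆ Finset.Icc 1 M) :
    ∀ k, m * M ≤ k → k < m * n → g k ∉ A := by
  obtain ⟨T, hT, hTA⟩ := h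
  intro k hk hkn hgk
  have hdiv : M ≤ k / m := (Nat.le_div_iff_mul_le hm).2 (by rwa [Nat.mul_comm])
  have hdiv' : k / m < n := Nat.div_lt_of_lt_mul hkn
  refine hT.not_selects (source m k) ⟨Nat.succ_pos _, hdiv'⟩ ?_ (g k) ?_ ⟨k, hkn, rfl, rfl⟩
  · rw [hTA]
    intro hs
    have := (Finset.mem_Icc.1 (hA (Finset.mem_coe.1 hs))).2
    unfold source at this
    omega
  · rw [hTA]
    exact Finset.mem_coe.2 hgk

/-- The union bound over the sets `A ∈ F` of candidates for the vertex set. -/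
theorem graphLaw_exists_le {m M n : ℕ} (hm : 1 ≤ m) (hM : 1 ≤ M) (hMn : M ≤ n)
    (F : Finset (Finset ℕ)) (hF : ∀ A ∈ F, A ⊆ Finset.Icc 1 M) :
    (graphLaw m n).toOuterMeasure {g | ∃ A ∈ F, IsMaxTreeVertexSet m n g A} ≤
      ENNReal.ofReal (∑ A ∈ F, ((2 * M / n : ℝ) ^ ((m : ℝ) / 2)) ^ A.card) := by
  have hsub : {g | ∃ A ∈ F, IsMaxTreeVertexSet m n g A} ⊆
      ⋃ A ∈ F, {g | ∀ k, m * M ≤ k → k < m * n → g k ∉ A} := by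
    rintro g ⟨A, hA, hg⟩
    exact Set.mem_biUnion hA (hg.avoid hm (hF A hA))
  refine (MeasureTheory.measure_mono hsub).trans
    ((MeasureTheory.measure_biUnion_finset_le F _).trans ?_)
  rw [ENNReal.ofReal_sum_of_nonneg fun A _ => by positivity]
  exact Finset.sum_le_sum fun A hA => graphLaw_avoid_le hm hM hMn (hF A hA)

theorem whp_of_compl_le {m : ℕ} {E : ℕ → Set (ℕ → ℕ)} {δ : ℕ → ℝ}
    (hδ : Tendsto δ atTop (𝓝 0))
    (h : ∀ᶠ n in atTop, (graphLaw m n).toOuterMeasure (E n)ᶜ ≤ ENNReal.ofReal (δ n)) :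
    Whp m E := by
  have hlim : Tendsto (fun n => 1 - ENNReal.ofReal (δ n)) atTop (𝓝 1) := by
    have := ENNReal.Tendsto.sub (tendsto_const_nhds (x := (1 : ℝ≥0∞)))
      (ENNReal.tendsto_ofReal hδ) (Or.inl ENNReal.one_ne_top)
    simpa using this
  refine tendsto_of_tendsto_of_tendsto_of_le_of_le' hlim tendsto_const_nhds ?_
    (Eventually.of_forall fun n => toOuterMeasure_le_one _ _)
  filter_upwards [h] with n hn
  refine tsub_le_iff_right.2 ?_
  calc (1 : ℝ≥0∞) = (graphLaw m n).toOuterMeasure (E n ∪ (E n)ᶜ) := by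
        rw [Set.union_compl_self, toOuterMeasure_univ]
    _ ≤ (graphLaw m n).toOuterMeasure (E n) + (graphLaw m n).toOuterMeasure (E n)ᶜ :=
        MeasureTheory.measure_union_le _ _
    _ ≤ _ := by gcongr

/-- Expand `(1 + q) ^ M` over subsets; the subtracted 1 is the term of the empty set, without which
the bound could not tend to 0. -/
theorem sum_nonempty_pow_card_le {q : ℝ} (hq : 0 ≤ q) (M : ℕ) :
    ∑ A ∈ (Finset.Icc 1 M).powerset.filter Finset.Nonempty, q ^ A.card ≤
      Real.exp (M * q) - 1 := by
  have hall : ∑ A ∈ (Finset.Icc 1 M).powerset, q ^ A.card = (1 + q) ^ M := by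
    have := Finset.prod_one_add (Finset.Icc 1 M) (f := fun _ => q)
    simpa using this.symm
  have hfilter : (Finset.Icc 1 M).powerset.filter Finset.Nonempty =
      (Finset.Icc 1 M).powerset.erase ∅ := by
    ext A
    simp [Finset.nonempty_iff_ne_empty, and_comm]
  have herase := Finset.sum_erase_add (Finset.Icc 1 M).powerset (fun A => q ^ A.card)
    (Finset.empty_mem_powerset _)
  rw [hall, Finset.card_empty, pow_zero] at herase
  have hexp : (1 + q) ^ M ≤ Real.exp (M * q) := by
    rw [Real.exp_nat_mul]
    exact pow_le_pow_left₀ (by positivity) (by linarith [Real.add_one_le_exp q]) M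
  rw [hfilter]
  linarith

theorem subset_Icc_floor {x : ℝ} {n : ℕ} {A : Finset ℕ} (hA : A ⊆ Finset.Icc 1 n)
    (h : ∀ a ∈ A, (a : ℝ) ≤ x) : A ⊆ Finset.Icc 1 ⌊x⌋₊ := fun a ha =>
  Finset.mem_Icc.2 ⟨(Finset.mem_Icc.1 (hA ha)).1, Nat.le_floor (h a ha)⟩

/-! ### The two asymptotic statements -/

theorem whp_no_early_maxTree {m : ℕ} (hm : 1 ≤ m) {s : ℝ} (hs : s < (m : ℝ) / (m + 2)) :
    Whp m fun n => {g | ¬ ∃ A : Finset ℕ,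
      (∀ a ∈ A, (a : ℝ) ≤ (n : ℝ) ^ s) ∧ IsMaxTreeVertexSet m n g A} := by
  have hm' : (1 : ℝ) ≤ m := by exact_mod_cast hm
  -- For `M ≤ n^s`, the product `Mq` is at most a constant times `n^(s + (s - 1)m/2) = n^(-e)`; `e >
  -- 0` exactly when `s < m/(m+2)`.
  set e : ℝ := (m : ℝ) / 2 - s * (1 + m / 2)
  have he : 0 < e := by
    rw [lt_div_iff₀ (by positivity)] at hs
    simp only [e]
    linarith
  have hs1 : s ≤ 1 := hs.le.trans ((div_le_one (by positivity)).2 (by linarith))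
  have hδ : Tendsto (fun n : ℕ => Real.exp ((2 : ℝ) ^ ((m : ℝ) / 2) * (n : ℝ) ^ (-e)) - 1)
      atTop (𝓝 0) := by
    have h1 := ((tendsto_rpow_neg_atTop he).comp tendsto_natCast_atTop_atTop).const_mul
      ((2 : ℝ) ^ ((m : ℝ) / 2))
    rw [mul_zero] at h1
    simpa using ((Real.continuous_exp.tendsto 0).comp h1).sub_const 1
  refine whp_of_compl_le hδ ?_
  filter_upwards [eventually_ge_atTop 1] with n hn
  have hn' : (1 : ℝ) ≤ n := by exact_mod_cast hn
  set M := ⌊(n : ℝ) ^ s⌋₊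
  have hMle : (M : ℝ) ≤ (n : ℝ) ^ s := Nat.floor_le (by positivity)
  have hMn : M ≤ n := by
    have : (n : ℝ) ^ s ≤ n := by
      simpa using Real.rpow_le_rpow_of_exponent_le hn' hs1
    exact_mod_cast hMle.trans this
  have hsub : {g | ¬ ∃ A : Finset ℕ,
      (∀ a ∈ A, (a : ℝ) ≤ (n : ℝ) ^ s) ∧ IsMaxTreeVertexSet m n g A}ᶜ ⊆
      {g | ∃ A ∈ (Finset.Icc 1 M).powerset.filter Finset.Nonempty,
        IsMaxTreeVertexSet m n g A} := by
    intro g hg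
    obtain ⟨A, hA, hT⟩ := not_not.1 hg
    exact ⟨A, Finset.mem_filter.2 ⟨Finset.mem_powerset.2 (subset_Icc_floor hT.subset_Icc hA),
      hT.nonempty⟩, hT⟩
  refine (MeasureTheory.measure_mono hsub).trans ?_
  -- `M = 0` does occur, when `s < 0`; then there are no candidates.
  rcases Nat.eq_zero_or_pos M with hM | hM
  · have hempty : (Finset.Icc 1 M).powerset.filter Finset.Nonempty = ∅ := by
      rw [hM]; decide
    rw [hempty]
    simp
  refine (graphLaw_exists_le hm hM hMn _ fun A hA =>
    Finset.mem_powerset.1 (Finset.mem_filter.1 hA).1).trans (ENNReal.ofReal_le_ofReal ?_)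
  refine (sum_nonempty_pow_card_le (by positivity) M).trans ?_
  refine sub_le_sub_right (Real.exp_le_exp.2 ?_) 1
  calc (M : ℝ) * (2 * M / n : ℝ) ^ ((m : ℝ) / 2)
      ≤ (n : ℝ) ^ s * (2 * (n : ℝ) ^ s / n : ℝ) ^ ((m : ℝ) / 2) := by gcongr
    _ = (2 : ℝ) ^ ((m : ℝ) / 2) * (n : ℝ) ^ (-e) := by
        have hn0 : (0 : ℝ) < n := by linarith
        rw [mul_div_assoc, ← Real.rpow_sub_one hn0.ne', Real.mul_rpow (by positivity)
          (by positivity), ← Real.rpow_mul hn0.le, mul_left_comm, ← Real.rpow_add hn0]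
        congr 2
        simp only [e]
        ring

theorem whp_no_dense_maxTree {m : ℕ} (hm : 1 ≤ m) {μ : ℕ → ℝ} (hμ : Tendsto μ atTop atTop)
    (hμn : μ =o[atTop] (fun n : ℕ => (n : ℝ))) {α : ℝ} (hα : 0 < α) :
    Whp m fun n => {g | ¬ ∃ A : Finset ℕ,
      (∀ a ∈ A, (a : ℝ) ≤ μ n) ∧ α * μ n ≤ (A.card : ℝ) ∧ IsMaxTreeVertexSet m n g A} := by
  have hm' : (1 : ℝ) ≤ m := by exact_mod_cast hm
  have hδ : Tendsto (fun n : ℕ => (1 / 2 : ℝ) ^ μ n) atTop (𝓝 0) :=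
    (tendsto_rpow_atTop_of_base_lt_one _ (by norm_num) (by norm_num)).comp hμ
  -- The base of the final bound: 2 from counting subsets, the rest from avoidance with `|A| ≥ αμ`.
  -- Once it is at most `1/2`, the failure probability is at most `(1/2)^μ`.
  have hratio : Tendsto (fun n : ℕ => 2 * (2 * (μ n / n)) ^ ((m : ℝ) / 2 * α)) atTop (𝓝 0) := by
    have h1 := (hμn.tendsto_div_nhds_zero.const_mul 2).rpow_const (p := (m : ℝ) / 2 * α)
      (Or.inr (by positivity))
    rw [mul_zero, Real.zero_rpow (by positivity)] at h1
    simpa using h1.const_mul 2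
  refine whp_of_compl_le hδ ?_
  filter_upwards [eventually_ge_atTop 1, hμ.eventually_ge_atTop 1,
    hratio.eventually_le_const (by norm_num : (0 : ℝ) < 1 / 2),
    -- This gives `M ≤ n` and `b ≤ 1`; the latter lets `|A|` be replaced by the smaller exponent
    -- `αμ`.
    hμn.tendsto_div_nhds_zero.eventually_le_const (by norm_num : (0 : ℝ) < 1 / 2)]
    with n hn hμ1 hq hhalf
  have hn' : (0 : ℝ) < n := by exact_mod_cast hn
  set M := ⌊μ n⌋₊
  have hMle : (M : ℝ) ≤ μ n := Nat.floor_le (by linarith)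
  have hM : 1 ≤ M := Nat.le_floor (by exact_mod_cast hμ1)
  have hMn : M ≤ n := by
    rw [div_le_iff₀ hn'] at hhalf
    exact_mod_cast (show (M : ℝ) ≤ n by linarith)
  set F := (Finset.Icc 1 M).powerset.filter fun A => α * μ n ≤ (A.card : ℝ)
  have hsub : {g | ¬ ∃ A : Finset ℕ,
      (∀ a ∈ A, (a : ℝ) ≤ μ n) ∧ α * μ n ≤ (A.card : ℝ) ∧ IsMaxTreeVertexSet m n g A}ᶜ ⊆
      {g | ∃ A ∈ F, IsMaxTreeVertexSet m n g A} := by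
    intro g hg
    obtain ⟨A, hA, hcard, hT⟩ := not_not.1 hg
    exact ⟨A, Finset.mem_filter.2 ⟨Finset.mem_powerset.2 (subset_Icc_floor hT.subset_Icc hA),
      hcard⟩, hT⟩
  refine (MeasureTheory.measure_mono hsub).trans ((graphLaw_exists_le hm hM hMn F fun A hA =>
    Finset.mem_powerset.1 (Finset.mem_filter.1 hA).1).trans (ENNReal.ofReal_le_ofReal ?_))
  set b : ℝ := 2 * (μ n / n)
  have hb0 : 0 < b := by positivity
  have hb1 : b ≤ 1 := by simp only [b]; linarith
  have hMb : (2 * M / n : ℝ) ≤ b := by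
    simp only [b]
    rw [mul_div_assoc]
    gcongr
  have hterm : ∀ A ∈ F, ((2 * M / n : ℝ) ^ ((m : ℝ) / 2)) ^ A.card ≤
      (b ^ ((m : ℝ) / 2 * α)) ^ μ n := by
    intro A hA
    have hcard := (Finset.mem_filter.1 hA).2
    calc ((2 * M / n : ℝ) ^ ((m : ℝ) / 2)) ^ A.card ≤ (b ^ ((m : ℝ) / 2)) ^ A.card := by gcongr
      _ = b ^ ((m : ℝ) / 2 * A.card) := by rw [← Real.rpow_natCast, ← Real.rpow_mul hb0.le]
      _ ≤ b ^ ((m : ℝ) / 2 * (α * μ n)) :=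
          Real.rpow_le_rpow_of_exponent_ge hb0 hb1 (by gcongr)
      _ = (b ^ ((m : ℝ) / 2 * α)) ^ μ n := by rw [← Real.rpow_mul hb0.le, mul_assoc]
  have hcardF : (F.card : ℝ) ≤ (2 : ℝ) ^ μ n := by
    have h1 : F.card ≤ 2 ^ M := by
      refine (Finset.card_filter_le _ _).trans ?_
      rw [Finset.card_powerset, Nat.card_Icc, Nat.add_sub_cancel]
    calc (F.card : ℝ) ≤ (2 : ℝ) ^ M := by exact_mod_cast h1
      _ = (2 : ℝ) ^ (M : ℝ) := (Real.rpow_natCast _ _).symm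
      _ ≤ (2 : ℝ) ^ μ n := Real.rpow_le_rpow_of_exponent_le one_le_two hMle
  calc ∑ A ∈ F, ((2 * M / n : ℝ) ^ ((m : ℝ) / 2)) ^ A.card
      ≤ F.card * (b ^ ((m : ℝ) / 2 * α)) ^ μ n := by
        simpa using Finset.sum_le_card_nsmul F _ _ hterm
    _ ≤ (2 : ℝ) ^ μ n * (b ^ ((m : ℝ) / 2 * α)) ^ μ n := by gcongr
    _ = (2 * b ^ ((m : ℝ) / 2 * α)) ^ μ n := (Real.mul_rpow zero_le_two (by positivity)).symm
    _ ≤ (1 / 2 : ℝ) ^ μ n := Real.rpow_le_rpow (by positivity) hq (by linarith)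

end PrefAttach

theorem mainTheorem7 (m : ℕ) (hm : 1 ≤ m) :
    (∀ ε : ℝ, 0 < ε →
      PrefAttach.Whp m fun n => {g | ¬ ∃ A : Finset ℕ,
        (∀ a ∈ A, (a : ℝ) ≤ (n : ℝ) ^ ((m : ℝ) / ((m : ℝ) + 4) - ε)) ∧
          PrefAttach.IsMaxTreeVertexSet m n g A}) ∧
    (∀ μ : ℕ → ℝ, Tendsto μ atTop atTop → μ =o[atTop] (fun n : ℕ => (n : ℝ)) →
      ∀ α : ℝ, 0 < α →
        PrefAttach.Whp m fun n => {g | ¬ ∃ A : Finset ℕ,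
          (∀ a ∈ A, (a : ℝ) ≤ μ n) ∧ α * μ n ≤ (A.card : ℝ) ∧
            PrefAttach.IsMaxTreeVertexSet m n g A}) := by
  refine ⟨fun ε hε => PrefAttach.whp_no_early_maxTree hm ?_,
    fun μ hμ hμn α hα => PrefAttach.whp_no_dense_maxTree hm hμ hμn hα⟩
  have hm' : (1 : ℝ) ≤ m := by exact_mod_cast hm
  -- The union bound reaches the larger exponent `m/(m+2)`; `ε` supplies strictness.
  have : (m : ℝ) / (m + 4) ≤ m / (m + 2) :=
    div_le_div_of_nonneg_left (by positivity) (by positivity) (by linarith)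
  linarith
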